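/- Let $k,q\ge 1$ be integers and let $T_{k,q}$ be the edgewise subdivision of the $(k-1)$-simplex $\{0\le x_1\le\dots\le x_{k-1}\le q\}$: its vertex set is $W_{k,q}=\{\mathbf v\in\mathbb Z^{k-1}:0\le v_1\le\dots\le v_{k-1}\le q\}$, and its facets are the simplices with vertices $\mathbf v,\ \mathbf v+e_{\pi_{k-1}},\ \dots,\ \mathbf v+e_{\pi_{k-1}}+\dots+e_{\pi_1}$, all lying in $W_{k,q}$, where $\pi\in\mathbb S_{k-1}$ is a permutation in which $i$ stands before $i+1$ whenever $v_i=v_{i+1}$. For a partition $\sigma=(\sigma^1,\dots,\sigma^r)$ of a positive integer let $P_\sigma=C_{\sigma^1}\times\dots\times C_{\sigma^r}$, where $C_m=\{0<1<\dots<m\}$, and let $K_\sigma=\Delta(P_\sigma\setminus\{\hat 0,\hat 1\})$ be its reduced order complex. Let $F$ be a $(t-1)$-dimensional face of $T_{k,q}$, $t\ge1$, with vertices $\mathbf v^{(1)}<\dots<\mathbf v^{(t)}$ in the componentwise order. For $i<t$ let $S_i\subseteq[k-1]$ be the set of indices of the coordinates in which $\mathbf v^{(i)}$ and $\mathbf v^{(i+1)}$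 differ, and let $S_t=[k]\setminus(S_1\cup\dots\cup S_{t-1})$. Put $\lambda_i=|S_i|$, and let $\sigma_i$ be the partition of $\lambda_i$ whose parts are the sizes of the classes into which $S_i$ is divided according to the values of the coordinates of $\mathbf v^{(i)}$, where the index $k$ and the indices of all coordinates equal to $0$ or $q$ are regarded as one class. Then $\lambda=(\lambda_1,\dots,\lambda_t)$ is a partition of $k$ into $t$ parts (up to the order of the parts), the pair $(\lambda,M)$ with the multiset $M=\{\sigma_1,\dots,\sigma_t\}$ is well defined and uniquely determined by $F$, and $$\mathrm{link}_{T_{k,q}}(F)\;\cong\;K_{\sigma_1}*K_{\sigma_2}*\dots*K_{\sigma_t},$$ a join of $t$ reduced order complexes of products of chains. In particular the combinatorial type of the link is determined by $(\lambda,M)$: any two faces of $T_{k,q}$ with the same pair have isomorphic links. -/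

import Mathlib

namespace EdgewiseLinks

/-! ### Simplicial complexes

Abstract simplicial complexes are Mathlib's `PreAbstractSimplicialComplex`: the nonempty faces are
listed, the empty face is understood to belong to every complex, and points of the ambient type
need not be vertices. -/

section Complexes

/-- The vertices of `K`. -/
def vertexSet {V : Type*} (K : PreAbstractSimplicialComplex V) : Set V :=
  {v | ({v} : Finset V) ∈ K.faces}

/-- `K ≅ L`: there is a bijection between the vertex sets under which faces correspond to faces. -/
def Isomorphic {V W : Type*} (K : PreAbstractSimplicialComplex V)
    (L : PreAbstractSimplicialComplex W) : Prop :=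
  ∃ e : vertexSet K ≃ vertexSet L, ∀ s : Finset (vertexSet K),
    s.map (Function.Embedding.subtype _) ∈ K.faces ↔
      (s.map e.toEmbedding).map (Function.Embedding.subtype _) ∈ L.faces

/-- The link of a face `F`: all `s` with `F ∩ s = ∅` and `F ∪ s` a face. -/
def link {V : Type*} [DecidableEq V] (K : PreAbstractSimplicialComplex V) (F : Finset V) :
    PreAbstractSimplicialComplex V where
  faces := {s | s.Nonempty ∧ F ∩ s = ∅ ∧ F ∪ s ∈ K.faces}
  isRelLowerSet_faces := by
    rintro s ⟨hs, hd, hu⟩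
    refine ⟨hs, fun u hus hu' => ⟨hu', ?_, ?_⟩⟩
    · exact Finset.subset_empty.1 (hd ▸ Finset.inter_subset_inter_left hus)
    · exact (K.isRelLowerSet_faces hu).2 (Finset.union_subset_union_right hus)
        (hu'.mono Finset.subset_union_right)

/-- The join of a family of complexes, on the disjoint union of the vertices: a face is a disjoint
union of faces (possibly empty) of the members. -/
def join {ι : Type*} {V : ι → Type*} (K : ∀ i, PreAbstractSimplicialComplex (V i)) :
    PreAbstractSimplicialComplex (Σ i, V i) where
  faces := {s | s.Nonempty ∧ ∀ i,
    s.preimage (Sigma.mk i) sigma_mk_injective.injOn = ∅ ∨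
    s.preimage (Sigma.mk i) sigma_mk_injective.injOn ∈ (K i).faces}
  isRelLowerSet_faces := by
    rintro s ⟨hs, h⟩
    refine ⟨hs, fun u hus hu => ⟨hu, fun i => ?_⟩⟩
    have hsub : u.preimage (Sigma.mk i) sigma_mk_injective.injOn ⊆
        s.preimage (Sigma.mk i) sigma_mk_injective.injOn := fun x hx => by
      rw [Finset.mem_preimage] at hx ⊢
      exact hus hx
    rcases Finset.eq_empty_or_nonempty
      (u.preimage (Sigma.mk i) sigma_mk_injective.injOn) with he | hne
    · exact Or.inl he
    · rcases h i with h0 | h1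
      · rw [h0] at hsub
        exact Or.inl (Finset.subset_empty.1 hsub)
      · exact Or.inr (((K i).isRelLowerSet_faces h1).2 hsub hne)

/-- The order complex `Δ(P)`: its faces are the finite chains of `P`. -/
def orderComplex (P : Type*) [PartialOrder P] : PreAbstractSimplicialComplex P where
  faces := {s | s.Nonempty ∧ IsChain (· ≤ ·) (s : Set P)}
  isRelLowerSet_faces := by
    rintro s ⟨hs, hc⟩
    exact ⟨hs, fun u hus hu => ⟨hu, hc.mono (Finset.coe_subset.2 hus)⟩⟩

/-- The reduced order complex `Δ(P \ {0̂, 1̂})`. -/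
def reducedOrderComplex (P : Type*) [PartialOrder P] [BoundedOrder P] :
    PreAbstractSimplicialComplex {x : P // x ≠ ⊥ ∧ x ≠ ⊤} :=
  orderComplex {x : P // x ≠ ⊥ ∧ x ≠ ⊤}

end Complexes

section ChainProducts

/-- The product `∏ C_m` over the members `m` of a multiset (with multiplicity), where
`C_m = {0 < 1 < ⋯ < m}` is the chain of length `m`; it carries the componentwise order. -/
abbrev ChainProduct (lengths : Multiset ℕ) : Type :=
  ∀ i : lengths.ToType, Fin (i.1 + 1)

/-- `K_σ = Δ(P_σ \ {0̂, 1̂})`, where `P_σ` is the product of the chains whose lengths are the parts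
of the partition `σ`. -/
def chainProductComplex {m : ℕ} (σ : m.Partition) :
    PreAbstractSimplicialComplex {x : ChainProduct σ.parts // x ≠ ⊥ ∧ x ≠ ⊤} :=
  reducedOrderComplex (ChainProduct σ.parts)

/-- The join of the complexes `K_σ`, one for each member `σ` (with multiplicity) of a multiset of
partitions. -/
def joinOfChainProductComplexes (M : Multiset (Σ m : ℕ, m.Partition)) :
    PreAbstractSimplicialComplex
      (Σ i : M.ToType, {x : ChainProduct i.1.2.parts // x ≠ ⊥ ∧ x ≠ ⊤}) :=
  join fun i : M.ToType => chainProductComplex i.1.2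

end ChainProducts

/-! ### The edgewise subdivision

Throughout `k = n + 1`; the coordinates are indexed by `Fin n` in place of `{1, …, k - 1}`, and
`Fin (n + 1)` stands for `{1, …, k}`, with `Fin.last n` in the role of `k`. -/

section Edgewise

/-- `W_{k,q}`: the integer points with `0 ≤ v₁ ≤ ⋯ ≤ v_{k-1} ≤ q`. -/
def latticePoints (n q : ℕ) : Set (Fin n → ℤ) :=
  {v | Monotone v ∧ ∀ i, 0 ≤ v i ∧ v i ≤ q}

/-- The permutation `π = π₁ ⋯ π_{k-1}` is consistent with `v`: `i` stands before `i + 1` in `π`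
whenever `v_i = v_{i+1}`. -/
def Consistent {n : ℕ} (v : Fin n → ℤ) (π : Equiv.Perm (Fin n)) : Prop :=
  ∀ i j : Fin n, (j : ℕ) = i + 1 → v i = v j → π.symm i < π.symm j

/-- `v` with the coordinates named by the last `m` letters of `π` increased by one. -/
def facetVertex {n : ℕ} (v : Fin n → ℤ) (π : Equiv.Perm (Fin n)) (m : Fin (n + 1)) :
    Fin n → ℤ :=
  v + ∑ j ∈ Finset.univ.filter (fun j : Fin n => n ≤ (j : ℕ) + m), Pi.single (π j) 1

/-- The vertex set of `F(v, π)`: the points `v, v + e_{π_{k-1}}, …, v + e_{π_{k-1}} + ⋯ + e_{π₁}`. -/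
def facet {n : ℕ} (v : Fin n → ℤ) (π : Equiv.Perm (Fin n)) : Finset (Fin n → ℤ) :=
  Finset.univ.image (facetVertex v π)

/-- The edgewise subdivision `T_{k,q}`, each simplex being given by its set of vertices. The facets
are the `F(v, π)` with `π` consistent with `v` and all vertices in `W_{k,q}`. -/
def edgewise (n q : ℕ) : PreAbstractSimplicialComplex (Fin n → ℤ) where
  faces := {s | s.Nonempty ∧ ∃ (v : Fin n → ℤ) (π : Equiv.Perm (Fin n)),
    v ∈ latticePoints n q ∧ Consistent v π ∧ (∀ w ∈ facet v π, w ∈ latticePoints n q) ∧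
      s ⊆ facet v π}
  isRelLowerSet_faces := by
    rintro s ⟨hs, v, π, hv, hc, hW, hsub⟩
    exact ⟨hs, fun u hus hu => ⟨hu, v, π, hv, hc, hW, hus.trans hsub⟩⟩

end Edgewise

/-! ### The pair `(λ, M)` of a face -/

section Pair

variable {n s : ℕ}

/-- `S_i`, for `i < t`: the indices of the coordinates in which `v⁽ⁱ⁾` and `v⁽ⁱ⁺¹⁾` differ. -/
def stepSet (v : Fin (s + 1) → Fin n → ℤ) (i : Fin s) : Finset (Fin (n + 1)) :=
  (Finset.univ.filter fun l : Fin n => v i.castSucc l ≠ v i.succ l).map Fin.castSuccEmb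

/-- `S_1, …, S_t` with `t = s + 1`, where `S_t = {1, …, k} \ (S_1 ∪ ⋯ ∪ S_{t-1})`. -/
def block (v : Fin (s + 1) → Fin n → ℤ) : Fin (s + 1) → Finset (Fin (n + 1)) :=
  Fin.snoc (α := fun _ => Finset (Fin (n + 1))) (stepSet v)
    (Finset.univ \ Finset.univ.biUnion (stepSet v))

/-- Two indices in the same block belong to the same chain if they carry equal coordinates of `w`;
the index `k`, the indices of coordinates `0` and the indices of coordinates `q` also belong
together. This function on indices separates exactly the chains. -/
def chainLabel (q : ℕ) (w : Fin n → ℤ) : Fin (n + 1) → ℤ :=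
  Fin.snoc (α := fun _ => ℤ) (fun l => if w l = q then 0 else w l) 0

/-- The lengths of the chains whose product is `P_{S_i}`: the sizes of the classes into which `S_i`
is divided by the coordinates of `v⁽ⁱ⁾`. -/
def chainLengths (q : ℕ) (v : Fin (s + 1) → Fin n → ℤ) (i : Fin (s + 1)) : Multiset ℕ :=
  ((block v i).image (chainLabel q (v i))).val.map fun x =>
    ((block v i).filter fun j => chainLabel q (v i) j = x).card

/-- `(λ, M)` is the pair of the face `F = {v⁽¹⁾ < ⋯ < v⁽ᵗ⁾}`: the parts of `λ` are the
`λ_i = |S_i|`, and `M` consists of the partitions `σ_i` whose parts are the lengths of the chains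
in `P_{S_i}`. -/
def IsPairOfFace (q : ℕ) (F : Finset (Fin n → ℤ)) (lam : (n + 1).Partition)
    (M : Multiset (Σ m : ℕ, m.Partition)) : Prop :=
  ∃ (s : ℕ) (v : Fin (s + 1) → Fin n → ℤ), StrictMono v ∧ Finset.univ.image v = F ∧
    lam.parts = Finset.univ.val.map (fun i => (block v i).card) ∧
    M.map (fun σ => σ.2.parts) = Finset.univ.val.map (chainLengths q v)

end Pair

end EdgewiseLinks

/-! Regard a point of `ℤ^{k-1}` as a point of `ℤ^k` modulo `(1, …, 1)`, normalised so that the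
`k`-th coordinate is `0`. The points adjacent to `w` or equal to it are then the classes `w + e_B`
(`shift w B`) for proper subsets `B` of `{1, …, k}`, and `w + e_B`, `w + e_C` are adjacent exactly
when `B` and `C` are comparable (`adjacent_shift_iff`).

The complex is flag: faces are the nonempty sets of pairwise adjacent lattice points
(`mem_edgewise_faces_iff`). Seen from its first vertex, a face `F` is a chain of proper subsets `∅ =
D_1 ⊂ ⋯ ⊂ D_t`, and the blocks `S_i` are its successive gaps, the last one up to the full set. A
vertex of the link is a set strictly between `D_i` and `D_i ∪ S_i` for some `i`. Sets from different
gaps are always comparable, hence the join.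

Within one gap write the set as `D_i ∪ A`. The resulting point is a lattice point iff `A` is an
upper set in each class of `S_i`, where the indices of coordinates `q`, the index `k` and the
indices of coordinates `0` form one class, in this cyclic order (`shift_mem_latticePoints_iff`). An
upper set of a finite chain is given by its size, so these `A` form the product of chains `P_{σ_i}`
(`exists_chainProduct_fiberUpperSets`), and `A = ∅`, `A = S_i` are the excluded bottom and top. -/

namespace EdgewiseLinks

/-! ### The edgewise subdivision as a flag complex -/

/-- Two lattice points span a face of the edgewise subdivision iff they are adjacent: they are
comparable and differ by at most one in every coordinate. -/
def Adjacent {n : ℕ} (u w : Fin n → ℤ) : Prop :=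
  (u ≤ w ∧ w ≤ u + 1) ∨ (w ≤ u ∧ u ≤ w + 1)

theorem Adjacent.symm {n : ℕ} {u w : Fin n → ℤ} (h : Adjacent u w) : Adjacent w u :=
  Or.symm h

theorem Adjacent.le_or_le {n : ℕ} {u w : Fin n → ℤ} (h : Adjacent u w) : u ≤ w ∨ w ≤ u :=
  h.imp And.left And.left

theorem Adjacent.le_add_one {n : ℕ} {u w : Fin n → ℤ} (h : Adjacent u w) (l : Fin n) :
    w l ≤ u l + 1 := by
  rcases h with h | h
  · exact h.2 l
  · have h' : w l ≤ u l := h.1 l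
    omega

theorem facetVertex_apply {n : ℕ} (v : Fin n → ℤ) (π : Equiv.Perm (Fin n)) (m : Fin (n + 1))
    (l : Fin n) :
    facetVertex v π m l = v l + if n ≤ (π.symm l : ℕ) + m then 1 else 0 := by
  have h : ∀ j : Fin n, (Pi.single (π j) (1 : ℤ) : Fin n → ℤ) l = if π.symm l = j then 1 else 0 := by
    intro j
    rw [Pi.single_apply]
    simp only [Equiv.symm_apply_eq]
  simp only [facetVertex, Pi.add_apply, Finset.sum_apply, h, Finset.sum_ite_eq, Finset.mem_filter,
    Finset.mem_univ, true_and]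

theorem adjacent_facetVertex {n : ℕ} (v : Fin n → ℤ) (π : Equiv.Perm (Fin n))
    (a b : Fin (n + 1)) : Adjacent (facetVertex v π a) (facetVertex v π b) := by
  rcases le_total (a : ℕ) b with h | h
  · left
    constructor <;> intro l <;> simp only [Pi.add_apply, Pi.one_apply, facetVertex_apply] <;>
      split_ifs <;> omega
  · right
    constructor <;> intro l <;> simp only [Pi.add_apply, Pi.one_apply, facetVertex_apply] <;>
      split_ifs <;> omega

/-- An upper set of `Fin n` is a final segment, so its size determines it; the inequality is the one
in `facetVertex_apply`. -/
theorem mem_iff_of_isUpperSet {n : ℕ} (T : Finset (Fin n)) (hT : IsUpperSet (T : Set (Fin n)))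
    (j : Fin n) : j ∈ T ↔ n ≤ (j : ℕ) + T.card := by
  constructor
  · intro hj
    have h : Finset.Ici j ⊆ T := fun x hx => hT (Finset.mem_Ici.1 hx) hj
    have := Finset.card_le_card h
    rw [Fin.card_Ici] at this
    omega
  · intro h
    by_contra hj
    have h' : T ⊆ Finset.Ioi j := fun x hx => by
      rw [Finset.mem_Ioi]
      by_contra hx'
      exact hj (hT (not_lt.1 hx') hx)
    have := Finset.card_le_card h'
    rw [Fin.card_Ioi] at this
    omega

/-- A chain of lattice points in a unit cube whose extreme corners are lattice points is contained
in a facet based at the bottom corner. -/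
theorem exists_subset_facet {n q : ℕ} (s : Finset (Fin n → ℤ)) (b : Fin n → ℤ)
    (hb : b ∈ latticePoints n q) (hb1 : b + 1 ∈ latticePoints n q)
    (hs : ∀ w ∈ s, w ∈ latticePoints n q) (hchain : ∀ u ∈ s, ∀ w ∈ s, u ≤ w ∨ w ≤ u)
    (hlo : ∀ w ∈ s, b ≤ w) (hhi : ∀ w ∈ s, w ≤ b + 1) :
    ∃ π : Equiv.Perm (Fin n), Consistent b π ∧ (∀ w ∈ facet b π, w ∈ latticePoints n q) ∧
      s ⊆ facet b π := by
  classical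
  -- Coordinates raised by more members of the chain come later in `π`, hence are raised earlier in
  -- the facet. Ties are broken by the index, as consistency demands.
  let f : Fin n → ℕ := fun l => (s.filter fun w => b l < w l).card
  let g : Fin n → ℕ ×ₗ Fin n := fun l => toLex (f l, l)
  have hginj : Function.Injective g := fun i j h => (Prod.ext_iff.1 (toLex.injective h)).2
  let π := Tuple.sort g
  have hmono : StrictMono (g ∘ π) :=
    (Tuple.monotone_sort g).strictMono_of_injective (hginj.comp π.injective)
  have hlt : ∀ i j, π.symm i < π.symm j ↔ g i < g j := by
    intro i j
    rw [← hmono.lt_iff_lt]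
    simp
  have hglt : ∀ i j, f i ≤ f j → i < j → g i < g j := by
    intro i j h1 h2
    rw [Prod.Lex.toLex_lt_toLex]
    rcases h1.lt_or_eq with h | h
    · exact Or.inl h
    · exact Or.inr ⟨h, h2⟩
  have hf : ∀ i j, i ≤ j → b i = b j → f i ≤ f j := by
    intro i j hij hbij
    refine Finset.card_le_card fun w hw => ?_
    rw [Finset.mem_filter] at hw ⊢
    have := (hs w hw.1).1 hij
    exact ⟨hw.1, by omega⟩
  refine ⟨π, ?_, ?_, ?_⟩
  · intro i j hij hbij
    have hij' : i < j := by rw [Fin.lt_def]; omega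
    exact (hlt i j).2 (hglt i j (hf i j hij'.le hbij) hij')
  · intro w hw
    simp only [facet, Finset.mem_image, Finset.mem_univ, true_and] at hw
    obtain ⟨m, rfl⟩ := hw
    refine ⟨fun i j hij => ?_, fun i => ?_⟩
    · rw [facetVertex_apply, facetVertex_apply]
      have h1 := hb.1 hij
      rcases hij.lt_or_eq with hij' | rfl
      -- A gap `b i < b j` absorbs the unit increase. On a tie, `i` precedes `j` in `π`, so `i` is
      -- raised only together with `j`.
      · rcases h1.lt_or_eq with h2 | h2
        · split_ifs <;> omega
        · have := (hlt i j).2 (hglt i j (hf i j hij h2) hij')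
          rw [Fin.lt_def] at this
          split_ifs <;> omega
      · exact le_rfl
    · rw [facetVertex_apply]
      have h1 := hb.2 i
      have h2 := hb1.2 i
      simp only [Pi.add_apply, Pi.one_apply] at h2
      split_ifs <;> omega
  · intro w hw
    let U : Finset (Fin n) := Finset.univ.filter fun j => b (π j) < w (π j)
    have hU : IsUpperSet (U : Set (Fin n)) := by
      intro i j hij hi
      simp only [U, Finset.coe_filter, Finset.mem_univ, true_and, Set.mem_ofPred_eq] at hi ⊢
      by_contra hj
      have hle : f (π i) ≤ f (π j) := by
        have := hmono.monotone hij
        rcases (Prod.Lex.toLex_le_toLex).1 this with h | h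
        · exact h.le
        · exact h.1.le
      -- Since `w` is not raised at `π j`, every member of the chain raised there lies above `w`,
      -- hence is raised at `π i`; `w` itself makes the inclusion strict.
      refine absurd hle (not_le.2 (Finset.card_lt_card ?_))
      rw [Finset.ssubset_iff_of_subset]
      · exact ⟨w, Finset.mem_filter.2 ⟨hw, hi⟩, fun h => hj (Finset.mem_filter.1 h).2⟩
      · intro u hu
        rw [Finset.mem_filter] at hu ⊢
        refine ⟨hu.1, ?_⟩
        rcases hchain u hu.1 w hw with h | h
        · exact absurd (hu.2.trans_le (h _)) hj
        · exact hi.trans_le (h _)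
    have hcard : U.card < n + 1 := Nat.lt_succ_of_le (by simpa using U.card_le_univ)
    simp only [facet, Finset.mem_image, Finset.mem_univ, true_and]
    refine ⟨⟨U.card, hcard⟩, funext fun l => ?_⟩
    have hl : b l < w l ↔ n ≤ (π.symm l : ℕ) + U.card := by
      rw [← mem_iff_of_isUpperSet U hU]
      simp [U]
    rw [facetVertex_apply]
    have h1 : b l ≤ w l := hlo w hw l
    have h2 : w l ≤ b l + 1 := hhi w hw l
    by_cases h : b l < w l
    · rw [if_pos (hl.1 h)]
      omega
    · rw [if_neg (fun h' => h (hl.2 h'))]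
      omega

/-- The edgewise subdivision is the flag complex of the adjacency relation on lattice points. -/
theorem mem_edgewise_faces_iff {n q : ℕ} (hq : 1 ≤ q) (s : Finset (Fin n → ℤ)) :
    s ∈ (edgewise n q).faces ↔
      s.Nonempty ∧ (∀ w ∈ s, w ∈ latticePoints n q) ∧ ∀ u ∈ s, ∀ w ∈ s, Adjacent u w := by
  constructor
  · rintro ⟨hne, v, π, -, -, hW, hsub⟩
    refine ⟨hne, fun w hw => hW w (hsub hw), fun u hu w hw => ?_⟩
    have hu' := hsub hu
    have hw' := hsub hw
    simp only [facet, Finset.mem_image, Finset.mem_univ, true_and] at hu' hw'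
    obtain ⟨a, rfl⟩ := hu'
    obtain ⟨c, rfl⟩ := hw'
    exact adjacent_facetVertex v π a c
  · rintro ⟨hne, hW, hadj⟩
    obtain ⟨M, hM⟩ := s.exists_maximal hne
    have hle : ∀ w ∈ s, w ≤ M := fun w hw =>
      (hadj w hw M hM.1).le_or_le.elim id fun h => hM.2 hw h
    have hMW := hW M hM.1
    -- The corner is `M - 1` truncated at `0`, which keeps it in the lattice region. The opposite
    -- corner is `max M 1`, bounded by `q` because `1 ≤ q`.
    have hb : (fun l => max (M l - 1) 0) ∈ latticePoints n q := by
      refine ⟨fun i j hij => ?_, fun i => ?_⟩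
      · have := hMW.1 hij
        simp only
        omega
      · have := hMW.2 i
        simp only
        omega
    refine ⟨hne, (fun l => max (M l - 1) 0), ?_⟩
    refine (exists_subset_facet s _ hb ?_ hW
      (fun u hu w hw => (hadj u hu w hw).le_or_le) ?_ ?_).imp fun π h => ⟨hb, h⟩
    · refine ⟨fun i j hij => ?_, fun i => ?_⟩
      · have := hMW.1 hij
        simp only [Pi.add_apply, Pi.one_apply]
        omega
      · have := hMW.2 i
        simp only [Pi.add_apply, Pi.one_apply]
        omega
    · intro w hw l
      have h1 := (hadj w hw M hM.1).le_add_one l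
      have h2 := (hW w hw).2 l
      simp only
      omega
    · intro w hw l
      have h1 : w l ≤ M l := hle w hw l
      simp only [Pi.add_apply, Pi.one_apply]
      omega

/-! ### Shifts of lattice points along subsets of `{1, …, k}` -/

section Shift

variable {n q : ℕ}

/-- Increase by one the coordinates with index in `A`, the index `k` being that of an additional
coordinate which is then normalised to zero by subtracting a constant. -/
def shift (w : Fin n → ℤ) (A : Finset (Fin (n + 1))) : Fin n → ℤ := fun l =>
  w l + (if l.castSucc ∈ A then 1 else 0) - (if Fin.last n ∈ A then 1 else 0)

/-- Within a class of indices, the cyclic order starting from the indices of coordinates `q`,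
followed by `k` and the indices of coordinates `0`. -/
def cyclicKey (q : ℕ) (w : Fin n → ℤ) : Fin (n + 1) → ℤ :=
  Fin.snoc (α := fun _ => ℤ) (fun l => if w l = q then (l : ℤ) - n else l + 1) 0

@[simp] theorem cyclicKey_castSucc (w : Fin n → ℤ) (l : Fin n) :
    cyclicKey q w l.castSucc = if w l = q then (l : ℤ) - n else l + 1 := by
  simp [cyclicKey]

@[simp] theorem cyclicKey_last (w : Fin n → ℤ) : cyclicKey q w (Fin.last n) = 0 := by
  simp [cyclicKey]

@[simp] theorem chainLabel_castSucc (w : Fin n → ℤ) (l : Fin n) :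
    chainLabel q w l.castSucc = if w l = q then 0 else w l := by
  simp [chainLabel]

@[simp] theorem chainLabel_last (w : Fin n → ℤ) : chainLabel q w (Fin.last n) = 0 := by
  simp [chainLabel]

theorem cyclicKey_injective (w : Fin n → ℤ) : Function.Injective (cyclicKey q w) := by
  intro l m h
  induction l using Fin.lastCases with
  | last =>
    induction m using Fin.lastCases with
    | last => rfl
    | cast m =>
      rw [cyclicKey_last, cyclicKey_castSucc] at h
      split_ifs at h <;> omega
  | cast l =>
    induction m using Fin.lastCases with
    | last =>
      rw [cyclicKey_last, cyclicKey_castSucc] at h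
      split_ifs at h <;> omega
    | cast m =>
      rw [cyclicKey_castSucc, cyclicKey_castSucc] at h
      congr 1
      ext
      split_ifs at h <;> omega

/-- Shifting along `A` preserves the lattice points iff `A` is an upper set in each class. -/
theorem shift_mem_latticePoints_iff (hq : 1 ≤ q) {w : Fin n → ℤ} (hw : w ∈ latticePoints n q)
    (A : Finset (Fin (n + 1))) :
    shift w A ∈ latticePoints n q ↔ ∀ l ∈ A, ∀ m, chainLabel q w l = chainLabel q w m →
      cyclicKey q w l < cyclicKey q w m → m ∈ A := by
  constructor
  · intro h l hl m hlab hkey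
    by_contra hm
    induction l using Fin.lastCases with
    | last =>
      induction m using Fin.lastCases with
      | last => exact hm hl
      | cast m =>
        simp only [chainLabel_last, chainLabel_castSucc, cyclicKey_last, cyclicKey_castSucc]
          at hlab hkey
        have h1 := (h.2 m).1
        simp only [shift, hl, hm, if_true, if_false] at h1
        split_ifs at hlab hkey <;> omega
    | cast l =>
      have h1 := h.2 l
      induction m using Fin.lastCases with
      | last =>
        simp only [chainLabel_last, chainLabel_castSucc, cyclicKey_last, cyclicKey_castSucc]
          at hlab hkey
        simp only [shift, hl, hm, if_true, if_false] at h1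
        split_ifs at hlab hkey <;> omega
      | cast m =>
        simp only [chainLabel_castSucc, cyclicKey_castSucc] at hlab hkey
        have h2 := h.2 m
        have h3 : l ≤ m → _ := fun h' => h.1 h'
        rw [Fin.le_def] at h3
        simp only [shift, hl, hm, if_true, if_false] at h1 h2 h3
        split_ifs at hlab hkey h1 h2 h3 <;> omega
  · intro h
    refine ⟨fun i j hij => ?_, fun i => ?_⟩
    · rcases hij.eq_or_lt with rfl | hij'
      · exact le_rfl
      have h0 := hw.1 hij
      have h1 := fun hi => h i.castSucc hi j.castSucc
      simp only [chainLabel_castSucc, cyclicKey_castSucc] at h1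
      simp only [shift]
      -- Equal coordinates lie in one class, ordered by index, so the upper set condition applies; a
      -- strict inequality leaves room for the increase.
      rcases h0.eq_or_lt with h2 | h2
      · rw [h2] at h1 ⊢
        by_cases hi : i.castSucc ∈ A
        · have := h1 hi rfl (by split_ifs <;> omega)
          simp [hi, this]
        · simp only [hi, if_false]
          split_ifs <;> omega
      · split_ifs <;> omega
    -- The bounds can fail only at a coordinate `q` raised without `k`, or at a coordinate `0` left
    -- behind when `k` is raised. Comparison with `k` in the common class excludes both.
    · have h0 := hw.2 i
      simp only [shift]
      have h1 := fun hi => h i.castSucc hi (Fin.last n)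
      have h2 := fun hi => h (Fin.last n) hi i.castSucc
      simp only [chainLabel_castSucc, cyclicKey_castSucc, chainLabel_last, cyclicKey_last] at h1 h2
      by_cases hi : i.castSucc ∈ A <;> by_cases hk : Fin.last n ∈ A <;>
        simp only [hi, hk, if_true, if_false, forall_const, imp_false, not_lt] at h1 h2 ⊢
      · omega
      · by_cases hiq : w i = q
        · simp only [hiq, if_true, forall_const] at h1
          omega
        · omega
      · by_cases hiq : w i = 0
        · have : w i ≠ q := by omega
          simp only [hiq, if_neg (hiq ▸ this), forall_const] at h2
          omega
        · omega
      · omega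

theorem shift_shift (w : Fin n → ℤ) {A B : Finset (Fin (n + 1))} (h : Disjoint A B) :
    shift (shift w A) B = shift w (A ∪ B) := by
  have h' : ∀ x, x ∈ A → x ∉ B := fun _ hx => Finset.disjoint_left.1 h hx
  funext l
  have h1 := h' l.castSucc
  have h2 := h' (Fin.last n)
  simp only [shift, Finset.mem_union]
  by_cases hA : l.castSucc ∈ A <;> by_cases hB : l.castSucc ∈ B <;>
    by_cases kA : Fin.last n ∈ A <;> by_cases kB : Fin.last n ∈ B <;> simp_all

theorem shift_empty (w : Fin n → ℤ) : shift w ∅ = w := by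
  funext l
  simp [shift]

theorem shift_univ (w : Fin n → ℤ) : shift w Finset.univ = w := by
  funext l
  simp [shift]

theorem adjacent_shift_of_subset (w : Fin n → ℤ) {B C : Finset (Fin (n + 1))} (h : B ⊆ C) :
    Adjacent (shift w B) (shift w C) := by
  have hk := @h (Fin.last n)
  by_cases hl : Fin.last n ∈ C ∧ Fin.last n ∉ B
  · right
    constructor <;> intro l <;> have hl' := @h l.castSucc <;>
      simp only [shift, hl, Pi.add_apply, Pi.one_apply, if_true, if_false] <;>
      split_ifs <;> first | omega | tauto
  · left
    constructor <;> intro l <;> have hl' := @h l.castSucc <;>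
      simp only [shift, Pi.add_apply, Pi.one_apply] <;>
      split_ifs <;> first | omega | tauto

/-- With `x ∈ B \ C` and `y ∈ C \ B`, passing from `B` to `C` changes the difference of the
coordinates `x` and `y` by two. For adjacent points all changes, that of the `k`-th coordinate being
zero, lie in `{0, 1}` or all lie in `{-1, 0}`. -/
theorem adjacent_shift_iff (w : Fin n → ℤ) (B C : Finset (Fin (n + 1))) :
    Adjacent (shift w B) (shift w C) ↔ B ⊆ C ∨ C ⊆ B := by
  refine ⟨fun h => ?_, fun h => h.elim (adjacent_shift_of_subset w)
    fun h => (adjacent_shift_of_subset w h).symm⟩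
  by_contra! hcon
  obtain ⟨h1, h2⟩ := hcon
  obtain ⟨x, hxB, hxC⟩ := Finset.not_subset.1 h1
  obtain ⟨y, hyC, hyB⟩ := Finset.not_subset.1 h2
  induction x using Fin.lastCases with
  | last =>
    induction y using Fin.lastCases with
    | last => exact hyB hxB
    | cast y =>
      have a1 := h.le_add_one y
      have a2 := h.symm.le_add_one y
      simp only [shift, hxB, hxC, hyB, hyC, if_true, if_false] at a1 a2
      omega
  | cast x =>
    induction y using Fin.lastCases with
    | last =>
      have a1 := h.le_add_one x
      have a2 := h.symm.le_add_one x
      simp only [shift, hxB, hxC, hyB, hyC, if_true, if_false] at a1 a2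
      omega
    | cast y =>
      have a3 := h.le_add_one y
      have a4 := h.symm.le_add_one x
      have a5 := h.le_add_one x
      have a6 := h.symm.le_add_one y
      rcases h.le_or_le with h | h
      · have a1 : shift w B x ≤ shift w C x := h x
        have a2 : shift w B y ≤ shift w C y := h y
        simp only [shift, hxB, hxC, hyB, hyC, if_true, if_false] at a1 a2 a3 a4 a5 a6
        split_ifs at * <;> omega
      · have a1 : shift w C x ≤ shift w B x := h x
        have a2 : shift w C y ≤ shift w B y := h y
        simp only [shift, hxB, hxC, hyB, hyC, if_true, if_false] at a1 a2 a3 a4 a5 a6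
        split_ifs at * <;> omega

/-- Equal shifts have indicator functions differing by a constant, so the only collision is between
`∅` and the full set. -/
theorem shift_injective_of_ne_univ (w : Fin n → ℤ) {B C : Finset (Fin (n + 1))}
    (hB : B ≠ Finset.univ) (hC : C ≠ Finset.univ) (h : shift w B = shift w C) : B = C := by
  have key : ∀ {B C : Finset (Fin (n + 1))}, B ≠ Finset.univ → shift w B = shift w C →
      Fin.last n ∈ B → Fin.last n ∈ C := by
    intro B C hB h hk
    by_contra hk'
    refine hB (Finset.eq_univ_iff_forall.2 fun x => ?_)
    induction x using Fin.lastCases with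
    | last => exact hk
    | cast x =>
      have := congrFun h x
      by_contra hx
      simp only [shift, hk, hk', hx, if_true, if_false] at this
      split_ifs at this <;> omega
  have hk : Fin.last n ∈ B ↔ Fin.last n ∈ C := ⟨key hB h, key hC h.symm⟩
  ext x
  induction x using Fin.lastCases with
  | last => exact hk
  | cast x =>
    have := congrFun h x
    simp only [shift, hk] at this
    by_cases h1 : x.castSucc ∈ B <;> by_cases h2 : x.castSucc ∈ C <;> simp_all

/-- The indices of the coordinates in which `u` and `w` differ. -/
def differSet (u w : Fin n → ℤ) : Finset (Fin (n + 1)) :=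
  (Finset.univ.filter fun l : Fin n => u l ≠ w l).map Fin.castSuccEmb

@[simp] theorem castSucc_mem_differSet {u w : Fin n → ℤ} {l : Fin n} :
    l.castSucc ∈ differSet u w ↔ u l ≠ w l := by
  simp [differSet]

@[simp] theorem last_notMem_differSet {u w : Fin n → ℤ} : Fin.last n ∉ differSet u w := by
  simp [differSet]

theorem shift_differSet {u w : Fin n → ℤ} (h1 : u ≤ w) (h2 : w ≤ u + 1) :
    shift u (differSet u w) = w := by
  funext l
  have h1 : u l ≤ w l := h1 l
  have h2 : w l ≤ u l + 1 := h2 l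
  simp only [shift, castSucc_mem_differSet, last_notMem_differSet, if_false]
  split_ifs <;> omega

theorem exists_shift_eq_of_adjacent {u w : Fin n → ℤ} (h : Adjacent u w) :
    ∃ B ≠ Finset.univ, shift u B = w := by
  rcases h with ⟨h1, h2⟩ | ⟨h1, h2⟩
  · exact ⟨differSet u w, fun h => last_notMem_differSet (h ▸ Finset.mem_univ _),
      shift_differSet h1 h2⟩
  · by_cases huw : u = w
    · exact ⟨∅, Finset.univ_nonempty.ne_empty.symm, by rw [shift_empty, huw]⟩
    obtain ⟨x, hx⟩ := Function.ne_iff.1 huw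
    -- Lowering the coordinates in a set amounts, modulo `(1, …, 1)`, to raising its complement,
    -- which contains `k`.
    refine ⟨Finset.univ \ differSet u w, fun h => ?_, funext fun l => ?_⟩
    · have := h ▸ Finset.mem_univ x.castSucc
      simp [hx] at this
    · have h1 : w l ≤ u l := h1 l
      have h2 : u l ≤ w l + 1 := h2 l
      simp only [shift, Finset.mem_sdiff, Finset.mem_univ, true_and, castSucc_mem_differSet,
        last_notMem_differSet, not_false_eq_true, if_true]
      split_ifs <;> omega

end Shift

/-! ### Upper sets in the fibers of a map, as a product of chains -/

section UpperSets

theorem exists_equiv_toType_map {ι κ : Type*} [Fintype ι] [DecidableEq κ] (f : ι → κ)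
    {m : Multiset κ} (hm : m = Finset.univ.val.map f) :
    ∃ e : m.ToType ≃ ι, ∀ i : m.ToType, i.1 = f (e i) := by
  classical
  subst hm
  -- A point of `ToType` is an element with a counter below its multiplicity; all multiplicities in
  -- `univ` are one.
  have hbij : Function.Bijective
      (fun i : (Finset.univ : Finset ι).val.ToType => (i.1 : ι)) := by
    constructor
    · rintro ⟨x, i⟩ ⟨y, j⟩ (rfl : x = y)
      have : Multiset.count x (Finset.univ : Finset ι).val = 1 :=
        Multiset.count_eq_one_of_mem Finset.univ.nodup (Finset.mem_univ x)
      congr 1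
      ext
      omega
    · intro x
      exact ⟨⟨x, 0, Multiset.count_pos.2 (Finset.mem_univ x)⟩, rfl⟩
  refine ⟨(Multiset.mapEquiv _ f).symm.trans (Equiv.ofBijective _ hbij), fun i => ?_⟩
  rw [Equiv.trans_apply, Equiv.ofBijective_apply]
  conv_lhs => rw [← (Multiset.mapEquiv _ f).apply_symm_apply i]
  exact Multiset.mapEquiv_apply _ f _

variable {α β : Type*}

/-- `A` is a subset of `S` which is an upper set, with respect to `key`, in each fiber of `c`. -/
def IsFiberUpperSet (S : Finset α) (c : α → β) (key : α → ℤ) (A : Finset α) : Prop :=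
  A ⊆ S ∧ ∀ l ∈ A, ∀ m ∈ S, c l = c m → key l < key m → m ∈ A

variable [DecidableEq β]

/-- The number of elements of `S` above `l` in the fiber of `l`. -/
def fiberRank (S : Finset α) (c : α → β) (key : α → ℤ) (l : α) : ℕ :=
  (S.filter fun m => c m = c l ∧ key l < key m).card

variable {S : Finset α} {c : α → β} {key : α → ℤ}

theorem fiberRank_lt_of_lt {l m : α} (hm : m ∈ S) (hc : c l = c m) (h : key l < key m) :
    fiberRank S c key m < fiberRank S c key l := by
  refine Finset.card_lt_card ((Finset.ssubset_iff_of_subset fun x hx => ?_).2 ⟨m, ?_, ?_⟩)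
  · rw [Finset.mem_filter] at hx ⊢
    exact ⟨hx.1, hx.2.1.trans hc.symm, h.trans hx.2.2⟩
  · exact Finset.mem_filter.2 ⟨hm, hc.symm, h⟩
  · simp

theorem fiberRank_lt_card {l : α} (hl : l ∈ S) :
    fiberRank S c key l < (S.filter fun j => c j = c l).card := by
  refine Finset.card_lt_card ((Finset.ssubset_iff_of_subset fun x hx => ?_).2 ⟨l, ?_, ?_⟩)
  · rw [Finset.mem_filter] at hx ⊢
    exact ⟨hx.1, hx.2.1⟩
  · exact Finset.mem_filter.2 ⟨hl, rfl⟩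
  · simp

theorem fiberRank_injOn (hkey : Function.Injective key) (b : β) :
    Set.InjOn (fiberRank S c key) (S.filter fun j => c j = b : Finset α) := by
  intro l hl m hm h
  rw [Finset.mem_coe, Finset.mem_filter] at hl hm
  rcases lt_trichotomy (key l) (key m) with h' | h' | h'
  · exact absurd h (fiberRank_lt_of_lt hm.1 (hl.2.trans hm.2.symm) h').ne'
  · exact hkey h'
  · exact absurd h (fiberRank_lt_of_lt hl.1 (hm.2.trans hl.2.symm) h').ne

/-- The ranks in a fiber are distinct and smaller than its size, so they take each value below that
size once. -/
theorem card_filter_fiberRank_lt (hkey : Function.Injective key) (b : β) {r : ℕ}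
    (hr : r ≤ (S.filter fun j => c j = b).card) :
    (S.filter fun l => c l = b ∧ fiberRank S c key l < r).card = r := by
  have himg : (S.filter fun j => c j = b).image (fiberRank S c key) =
      Finset.range (S.filter fun j => c j = b).card := by
    refine Finset.eq_of_subset_of_card_le (fun x hx => ?_) ?_
    · obtain ⟨l, hl, rfl⟩ := Finset.mem_image.1 hx
      obtain ⟨hl', rfl⟩ := Finset.mem_filter.1 hl
      exact Finset.mem_range.2 (fiberRank_lt_card hl')
    · rw [Finset.card_range, Finset.card_image_of_injOn (fiberRank_injOn hkey b)]
  have himg' : (S.filter fun l => c l = b ∧ fiberRank S c key l < r).image (fiberRank S c key) =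
      Finset.range r := by
    ext x
    rw [Finset.mem_image, Finset.mem_range]
    constructor
    · rintro ⟨l, hl, rfl⟩
      exact (Finset.mem_filter.1 hl).2.2
    · intro hx
      have : x ∈ (S.filter fun j => c j = b).image (fiberRank S c key) := by
        rw [himg, Finset.mem_range]
        exact hx.trans_le hr
      obtain ⟨l, hl, rfl⟩ := Finset.mem_image.1 this
      obtain ⟨hl, hb⟩ := Finset.mem_filter.1 hl
      exact ⟨l, Finset.mem_filter.2 ⟨hl, hb, hx⟩, rfl⟩
  rw [← Finset.card_image_of_injOn (f := fiberRank S c key), himg', Finset.card_range]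
  refine (fiberRank_injOn (S := S) (c := c) hkey b).mono fun l hl => ?_
  rw [Finset.mem_coe, Finset.mem_filter] at hl ⊢
  exact ⟨hl.1, hl.2.1⟩

/-- In the fiber of `l`, an upper set containing `l` contains `l` and all elements above it, while
one omitting `l` has only elements above `l`. So its size in each fiber determines it. -/
theorem IsFiberUpperSet.mem_iff (hkey : Function.Injective key) {A : Finset α}
    (hA : IsFiberUpperSet S c key A) {l : α} (hl : l ∈ S) :
    l ∈ A ↔ fiberRank S c key l < (A.filter fun j => c j = c l).card := by
  constructor
  · intro h
    refine Finset.card_lt_card ((Finset.ssubset_iff_of_subset fun x hx => ?_).2 ⟨l, ?_, ?_⟩)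
    · rw [Finset.mem_filter] at hx ⊢
      exact ⟨hA.2 l h x hx.1 hx.2.1.symm hx.2.2, hx.2.1⟩
    · exact Finset.mem_filter.2 ⟨h, rfl⟩
    · simp
  · intro h
    by_contra hlA
    refine absurd h (not_lt.2 (Finset.card_le_card fun x hx => ?_))
    rw [Finset.mem_filter] at hx ⊢
    refine ⟨hA.1 hx.1, hx.2, ?_⟩
    by_contra hk
    rcases (not_lt.1 hk).lt_or_eq with h' | h'
    · exact hlA (hA.2 x hx.1 l hl hx.2 h')
    · exact hlA (hkey h' ▸ hx.1)

/-- The upper sets in the fibers of `c` form a product of chains. -/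
theorem exists_chainProduct_fiberUpperSets (hkey : Function.Injective key) {m : Multiset ℕ}
    (hm : m = (S.image c).val.map fun x => (S.filter fun j => c j = x).card) :
    ∃ a : ChainProduct m → Finset α, (∀ x y, a x ⊆ a y ↔ x ≤ y) ∧ a ⊥ = ∅ ∧ a ⊤ = S ∧
      ∀ A, (∃ x, a x = A) ↔ IsFiberUpperSet S c key A := by
  have hm' : m = (Finset.univ : Finset {b // b ∈ S.image c}).val.map
      fun b => (S.filter fun j => c j = b.1).card := by
    rw [hm, Finset.univ_eq_attach, Finset.attach_val]
    exact (Multiset.attach_map_val' _ _).symm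
  obtain ⟨e, he⟩ := exists_equiv_toType_map _ hm'
  -- The tuple `x`, reindexed by labels, bounds the ranks admitted in each fiber. The value `0` off
  -- the image of `S` is never used.
  let t : ChainProduct m → β → ℕ := fun x b =>
    if h : b ∈ S.image c then (x (e.symm ⟨b, h⟩) : ℕ) else 0
  have ht : ∀ x i, t x (e i).1 = x i := by
    intro x i
    have h : (e i).1 ∈ S.image c := (e i).2
    simp only [t, dif_pos h]
    rw [Subtype.coe_eta, e.symm_apply_apply]
  let a : ChainProduct m → Finset α := fun x => S.filter fun l => fiberRank S c key l < t x (c l)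
  have hcard : ∀ x i, ((a x).filter fun j => c j = (e i).1).card = x i := by
    intro x i
    rw [← card_filter_fiberRank_lt (S := S) (c := c) (key := key) hkey (e i).1 (r := x i)
      (by have := (x i).2; rw [← he i]; omega), ← ht x i]
    congr 1
    ext l
    simp only [a, Finset.mem_filter]
    constructor
    · rintro ⟨⟨h1, h2⟩, h3⟩
      exact ⟨h1, h3, h3 ▸ h2⟩
    · rintro ⟨h1, h3, h2⟩
      exact ⟨⟨h1, h3 ▸ h2⟩, h3⟩
  have hlabel : ∀ l ∈ S, ∃ i, (e i).1 = c l := fun l hl =>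
    ⟨e.symm ⟨c l, Finset.mem_image_of_mem c hl⟩, by rw [e.apply_symm_apply]⟩
  refine ⟨a, fun x y => ⟨fun h i => ?_, fun h l hl => ?_⟩, ?_, ?_, fun A => ⟨?_, fun hA => ?_⟩⟩
  · rw [Fin.le_def, ← hcard x i, ← hcard y i]
    exact Finset.card_le_card (Finset.filter_subset_filter _ h)
  · obtain ⟨hl, hr⟩ := Finset.mem_filter.1 hl
    refine Finset.mem_filter.2 ⟨hl, hr.trans_le ?_⟩
    obtain ⟨i, hi⟩ := hlabel l hl
    rw [← hi, ht, ht]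
    exact h i
  · refine Finset.filter_eq_empty_iff.2 fun l hl => ?_
    obtain ⟨i, hi⟩ := hlabel l hl
    rw [← hi, ht]
    exact Nat.not_lt_zero _
  · refine Finset.filter_eq_self.2 fun l hl => ?_
    obtain ⟨i, hi⟩ := hlabel l hl
    have h := fiberRank_lt_card (c := c) (key := key) hl
    rw [← hi, ← he i] at h
    rw [← hi, ht]
    simpa [Fin.val_last] using h
  · rintro ⟨x, rfl⟩
    refine ⟨Finset.filter_subset _ _, fun l hl m hm hc hk => ?_⟩
    have hl := (Finset.mem_filter.1 hl).2
    exact Finset.mem_filter.2 ⟨hm, (fiberRank_lt_of_lt hm hc hk).trans (hc ▸ hl)⟩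
  · let x : ChainProduct m := fun i => ⟨(A.filter fun j => c j = (e i).1).card, by
      rw [he i]
      exact Nat.lt_succ_of_le (Finset.card_le_card (Finset.filter_subset_filter _ hA.1))⟩
    have hx : ∀ i, t x (e i).1 = (A.filter fun j => c j = (e i).1).card := ht x
    have hmem : ∀ l ∈ S, (l ∈ A ↔ fiberRank S c key l < t x (c l)) := by
      intro l hl
      obtain ⟨i, hi⟩ := hlabel l hl
      rw [hA.mem_iff hkey hl, ← hi, hx]
    refine ⟨x, Finset.ext fun l => Finset.mem_filter.trans ?_⟩
    exact ⟨fun h => (hmem l h.1).2 h.2, fun h => ⟨hA.1 h, (hmem l (hA.1 h)).1 h⟩⟩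

end UpperSets

/-! ### Isomorphisms of complexes and faces of a join -/

section Isomorphisms

variable {U V W : Type*} {J : PreAbstractSimplicialComplex U} {K : PreAbstractSimplicialComplex V}
  {L : PreAbstractSimplicialComplex W}

theorem Isomorphic.symm (h : Isomorphic K L) : Isomorphic L K := by
  obtain ⟨e, he⟩ := h
  refine ⟨e.symm, fun s => ?_⟩
  rw [he, Finset.map_map e.symm.toEmbedding]
  have : e.symm.toEmbedding.trans e.toEmbedding = Function.Embedding.refl _ := by
    ext x
    simp
  rw [this, Finset.map_refl]

theorem Isomorphic.trans (h : Isomorphic J K) (h' : Isomorphic K L) : Isomorphic J L := by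
  obtain ⟨e, he⟩ := h
  obtain ⟨e', he'⟩ := h'
  refine ⟨e.trans e', fun s => ?_⟩
  rw [he, he', Finset.map_map e.toEmbedding]
  rfl

/-- Ambient points need not be vertices, so `f` only has to reach the vertices of `K`. -/
theorem isomorphic_of_injective (f : W ↪ V) (h : ∀ t, t ∈ L.faces ↔ t.map f ∈ K.faces)
    (hrange : ∀ v ∈ vertexSet K, ∃ w, f w = v) : Isomorphic K L := by
  have hmem : ∀ w, w ∈ vertexSet L ↔ f w ∈ vertexSet K := fun w => by
    simp only [vertexSet, Set.mem_ofPred_eq, h, Finset.map_singleton]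
  let g : vertexSet L → vertexSet K := fun w => ⟨f w, (hmem w).1 w.2⟩
  have hg : Function.Bijective g := by
    refine ⟨fun x y hxy => Subtype.ext (f.injective (congrArg Subtype.val hxy)), fun v => ?_⟩
    obtain ⟨w, hw⟩ := hrange v v.2
    exact ⟨⟨w, (hmem w).2 (hw.symm ▸ v.2)⟩, Subtype.ext hw⟩
  refine Isomorphic.symm ⟨Equiv.ofBijective g hg, fun s => ?_⟩
  rw [h, Finset.map_map, Finset.map_map]
  rfl

theorem mem_join_orderComplex_faces_iff {ι : Type*} {P : ι → Type*} [∀ i, PartialOrder (P i)]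
    (t : Finset (Σ i, P i)) : t ∈ (join fun i => orderComplex (P i)).faces ↔
      t.Nonempty ∧ ∀ i x y, ⟨i, x⟩ ∈ t → ⟨i, y⟩ ∈ t → x ≤ y ∨ y ≤ x := by
  refine and_congr_right fun _ => forall_congr' fun i => ?_
  constructor
  · rintro (h | h) x y hx hy
    · have : x ∈ t.preimage (Sigma.mk i) sigma_mk_injective.injOn := Finset.mem_preimage.2 hx
      rw [h] at this
      exact absurd this (Finset.notMem_empty x)
    · exact h.2.total (Finset.mem_coe.2 (Finset.mem_preimage.2 hx))
        (Finset.mem_coe.2 (Finset.mem_preimage.2 hy))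
  · intro h
    rcases Finset.eq_empty_or_nonempty
      (t.preimage (Sigma.mk i) sigma_mk_injective.injOn) with he | hne
    · exact Or.inl he
    · refine Or.inr ⟨hne, fun x hx y hy _ => ?_⟩
      exact h x y (Finset.mem_preimage.1 hx) (Finset.mem_preimage.1 hy)

end Isomorphisms

/-! ### The chain of subsets attached to a face, and its gaps -/

section Blocks

variable {n q s : ℕ} {v : Fin (s + 1) → Fin n → ℤ}

theorem block_castSucc (v : Fin (s + 1) → Fin n → ℤ) (i : Fin s) :
    block v i.castSucc = differSet (v i.castSucc) (v i.succ) := by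
  simp only [block, Fin.snoc_castSucc]
  rfl

theorem block_last (v : Fin (s + 1) → Fin n → ℤ) :
    block v (Fin.last s) = Finset.univ \ Finset.univ.biUnion (stepSet v) := by
  simp only [block, Fin.snoc_last]

theorem block_nonempty (hv : StrictMono v) (i : Fin (s + 1)) : (block v i).Nonempty := by
  induction i using Fin.lastCases with
  | last =>
    refine ⟨Fin.last n, ?_⟩
    rw [block_last]
    simp [stepSet]
  | cast i =>
    obtain ⟨l, hl⟩ := Function.ne_iff.1 (hv i.castSucc_lt_succ).ne
    exact ⟨l.castSucc, by rwa [block_castSucc, castSucc_mem_differSet]⟩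

theorem biUnion_block (v : Fin (s + 1) → Fin n → ℤ) :
    Finset.univ.biUnion (block v) = Finset.univ := by
  refine Finset.eq_univ_iff_forall.2 fun x => ?_
  by_cases hx : x ∈ Finset.univ.biUnion (stepSet v)
  · obtain ⟨i, -, hi⟩ := Finset.mem_biUnion.1 hx
    refine Finset.mem_biUnion.2 ⟨i.castSucc, Finset.mem_univ _, ?_⟩
    rw [block_castSucc]
    exact hi
  · refine Finset.mem_biUnion.2 ⟨Fin.last s, Finset.mem_univ _, ?_⟩
    rw [block_last, Finset.mem_sdiff]
    exact ⟨Finset.mem_univ _, hx⟩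

theorem differSet_mono (hv : StrictMono v) {i j : Fin (s + 1)} (h : i ≤ j) :
    differSet (v 0) (v i) ⊆ differSet (v 0) (v j) := by
  intro x hx
  induction x using Fin.lastCases with
  | last => simp at hx
  | cast l =>
    rw [castSucc_mem_differSet] at hx ⊢
    have h1 : v 0 l ≤ v i l := hv.monotone (Fin.zero_le i) l
    have h2 : v i l ≤ v j l := hv.monotone h l
    omega

/-- Along an increasing chain nothing cancels: a coordinate changes at some step iff its end values
differ. -/
theorem biUnion_stepSet (hv : StrictMono v) :
    Finset.univ.biUnion (stepSet v) = differSet (v 0) (v (Fin.last s)) := by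
  ext x
  rw [Finset.mem_biUnion]
  constructor
  · rintro ⟨i, -, hi⟩
    change x ∈ differSet (v i.castSucc) (v i.succ) at hi
    induction x using Fin.lastCases with
    | last => simp at hi
    | cast l =>
      rw [castSucc_mem_differSet] at hi ⊢
      have h1 : v 0 l ≤ v i.castSucc l := hv.monotone (Fin.zero_le _) l
      have h2 : v i.castSucc l ≤ v i.succ l := hv.monotone i.castSucc_lt_succ.le l
      have h3 : v i.succ l ≤ v (Fin.last s) l := hv.monotone (Fin.le_last _) l
      omega
  · intro hx
    by_contra! hcon
    have h : ∀ i, x ∉ differSet (v 0) (v i) := by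
      intro i
      induction i using Fin.induction with
      | zero =>
        induction x using Fin.lastCases with
        | last => simp
        | cast l => simp
      | succ i ih =>
        have := hcon i (Finset.mem_univ i)
        change x ∉ differSet (v i.castSucc) (v i.succ) at this
        induction x using Fin.lastCases with
        | last => simp
        | cast l =>
          rw [castSucc_mem_differSet] at this ih ⊢
          omega
    exact h _ hx

theorem differSet_union_block_castSucc (hv : StrictMono v) (i : Fin s) :
    differSet (v 0) (v i.castSucc) ∪ block v i.castSucc = differSet (v 0) (v i.succ) := by
  ext x
  rw [block_castSucc, Finset.mem_union]
  induction x using Fin.lastCases with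
  | last => simp
  | cast l =>
    simp only [castSucc_mem_differSet]
    have h3 : v 0 l ≤ v i.castSucc l := hv.monotone (Fin.zero_le _) l
    have h4 : v i.castSucc l ≤ v i.succ l := hv.monotone i.castSucc_lt_succ.le l
    omega

theorem differSet_union_block_last (hv : StrictMono v) :
    differSet (v 0) (v (Fin.last s)) ∪ block v (Fin.last s) = Finset.univ := by
  rw [block_last, biUnion_stepSet hv, Finset.union_sdiff_of_subset (Finset.subset_univ _)]

theorem differSet_union_block_subset (hv : StrictMono v) {i j : Fin (s + 1)} (h : i < j) :
    differSet (v 0) (v i) ∪ block v i ⊆ differSet (v 0) (v j) := by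
  induction i using Fin.lastCases with
  | last => exact absurd h (not_lt.2 (Fin.le_last j))
  | cast i =>
    rw [differSet_union_block_castSucc hv]
    exact differSet_mono hv ((Fin.castSucc_lt_iff_succ_le.1 h))

/-- A set comparable with all members of the chain lies between two consecutive members. -/
theorem exists_between_differSet (hv : StrictMono v) {B : Finset (Fin (n + 1))}
    (hB : B ≠ Finset.univ)
    (hne : ∀ i, B ≠ differSet (v 0) (v i))
    (hcomp : ∀ i, B ⊆ differSet (v 0) (v i) ∨ differSet (v 0) (v i) ⊆ B) :
    ∃ i, differSet (v 0) (v i) ⊂ B ∧ B ⊂ differSet (v 0) (v i) ∪ block v i := by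
  have h0 : differSet (v 0) (v 0) ⊆ B := by
    intro x hx
    induction x using Fin.lastCases with
    | last => simp at hx
    | cast l => simp at hx
  -- The gap is the one after the last member of the chain contained in `B`.
  obtain ⟨i, hi, hmax⟩ := (Finset.univ.filter fun i => differSet (v 0) (v i) ⊆ B).exists_maximal
    ⟨0, Finset.mem_filter.2 ⟨Finset.mem_univ _, h0⟩⟩
  have hi := (Finset.mem_filter.1 hi).2
  refine ⟨i, hi.ssubset_of_ne (hne i).symm, ?_⟩
  induction i using Fin.lastCases with
  | last =>
    rw [differSet_union_block_last hv]
    exact (Finset.subset_univ B).ssubset_of_ne hB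
  | cast i =>
    rw [differSet_union_block_castSucc hv]
    refine ((hcomp i.succ).resolve_right fun h => ?_).ssubset_of_ne (hne i.succ)
    have := hmax (Finset.mem_filter.2 ⟨Finset.mem_univ _, h⟩) i.castSucc_lt_succ.le
    exact absurd this (not_le.2 i.castSucc_lt_succ)

theorem shift_differSet_zero (hv : StrictMono v)
    (hadj : ∀ i j, Adjacent (v i) (v j)) (i : Fin (s + 1)) :
    shift (v 0) (differSet (v 0) (v i)) = v i :=
  shift_differSet (hv.monotone (Fin.zero_le i)) fun l => (hadj 0 i).le_add_one l

/-- A coordinate raised before step `i` and again at step `i` would differ by two between `v 0` and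
`v i.succ`, which are adjacent. -/
theorem disjoint_differSet_block (hv : StrictMono v)
    (hadj : ∀ i j, Adjacent (v i) (v j)) (i : Fin (s + 1)) :
    Disjoint (differSet (v 0) (v i)) (block v i) := by
  induction i using Fin.lastCases with
  | last =>
    rw [block_last, biUnion_stepSet hv]
    exact Finset.disjoint_sdiff
  | cast i =>
    rw [block_castSucc, Finset.disjoint_left]
    intro x h1 h2
    induction x using Fin.lastCases with
    | last => simp at h1
    | cast l =>
      rw [castSucc_mem_differSet] at h1 h2
      have h3 : v 0 l ≤ v i.castSucc l := hv.monotone (Fin.zero_le _) l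
      have h4 : v i.castSucc l ≤ v i.succ l := hv.monotone i.castSucc_lt_succ.le l
      have h5 := (hadj 0 i.succ).le_add_one l
      omega

theorem card_block_sum (hv : StrictMono v)
    (hadj : ∀ i j, Adjacent (v i) (v j)) : ∑ i, (block v i).card = n + 1 := by
  rw [← Finset.card_biUnion, biUnion_block, Finset.card_univ, Fintype.card_fin]
  have h : ∀ i j, i < j → Disjoint (block v i) (block v j) := fun i j hij =>
    (disjoint_differSet_block hv hadj j).mono_left
      (Finset.subset_union_right.trans (differSet_union_block_subset hv hij))
  intro i _ j _ hij
  exact hij.lt_or_gt.elim (h i j) fun h' => (h j i h').symm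

theorem shift_eq_shift_zero (hv : StrictMono v)
    (hadj : ∀ i j, Adjacent (v i) (v j)) (i : Fin (s + 1)) {A : Finset (Fin (n + 1))}
    (hA : A ⊆ block v i) :
    shift (v i) A = shift (v 0) (differSet (v 0) (v i) ∪ A) := by
  rw [← shift_shift _ ((disjoint_differSet_block hv hadj i).mono_right hA),
    shift_differSet_zero hv hadj]

/-- The lattice criterion tests all indices, the fiber condition only those in the block. They agree
because the block is itself an upper set in each class: shifting along it gives the next vertex of
the face, or the first one after the last block. -/
theorem shift_mem_latticePoints_iff_isFiberUpperSet (hv : StrictMono v)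
    (hadj : ∀ i j, Adjacent (v i) (v j)) (hq : 1 ≤ q)
    (hW : ∀ i, v i ∈ latticePoints n q) (i : Fin (s + 1)) {A : Finset (Fin (n + 1))}
    (hA : A ⊆ block v i) :
    shift (v i) A ∈ latticePoints n q ↔
      IsFiberUpperSet (block v i) (chainLabel q (v i)) (cyclicKey q (v i)) A := by
  have hblock : shift (v i) (block v i) ∈ latticePoints n q := by
    rw [shift_eq_shift_zero hv hadj i subset_rfl]
    induction i using Fin.lastCases with
    | last =>
      rw [differSet_union_block_last hv, shift_univ]
      exact hW 0
    | cast i =>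
      rw [differSet_union_block_castSucc hv, shift_differSet_zero hv hadj]
      exact hW _
  rw [shift_mem_latticePoints_iff hq (hW i)] at hblock ⊢
  exact ⟨fun h => ⟨hA, fun l hl m _ => h l hl m⟩,
    fun h l hl m hc hk => h.2 l hl m (hblock l (hA hl) m hc hk) hc hk⟩

end Blocks

/-! ### The link as a join -/

section Links

variable {n q s : ℕ} {v : Fin (s + 1) → Fin n → ℤ}

theorem adjacent_of_mem_faces (hq : 1 ≤ q) (hF : Finset.univ.image v ∈ (edgewise n q).faces)
    (i j : Fin (s + 1)) : Adjacent (v i) (v j) :=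
  ((mem_edgewise_faces_iff hq _).1 hF).2.2 _ (Finset.mem_image_of_mem v (Finset.mem_univ i)) _
    (Finset.mem_image_of_mem v (Finset.mem_univ j))

/-- By flagness, only pairwise conditions have to be checked on the union with the face. -/
theorem mem_link_edgewise_faces_iff (hq : 1 ≤ q)
    (hF : Finset.univ.image v ∈ (edgewise n q).faces) (t : Finset (Fin n → ℤ)) :
    t ∈ (link (edgewise n q) (Finset.univ.image v)).faces ↔ t.Nonempty ∧
      (∀ w ∈ t, w ∈ latticePoints n q ∧ (∀ i, w ≠ v i) ∧ ∀ i, Adjacent w (v i)) ∧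
      ∀ u ∈ t, ∀ w ∈ t, Adjacent u w := by
  have hv : ∀ i, v i ∈ Finset.univ.image v := fun i =>
    Finset.mem_image_of_mem v (Finset.mem_univ i)
  refine and_congr_right fun hne => ?_
  rw [mem_edgewise_faces_iff hq] at hF ⊢
  constructor
  · rintro ⟨hd, -, hW, hadj⟩
    refine ⟨fun w hw => ⟨hW w (Finset.mem_union_right _ hw), fun i hi => ?_, fun i => ?_⟩,
      fun u hu w hw => hadj u (Finset.mem_union_right _ hu) w (Finset.mem_union_right _ hw)⟩
    · have := Finset.mem_inter.2 ⟨hv i, hi ▸ hw⟩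
      rw [hd] at this
      exact Finset.notMem_empty _ this
    · exact hadj w (Finset.mem_union_right _ hw) _ (Finset.mem_union_left _ (hv i))
  · rintro ⟨h, hadj⟩
    refine ⟨?_, hF.1.mono Finset.subset_union_left, fun w hw => ?_, fun u hu w hw => ?_⟩
    · refine Finset.eq_empty_of_forall_notMem fun w hw => ?_
      obtain ⟨hw1, hw2⟩ := Finset.mem_inter.1 hw
      obtain ⟨i, -, rfl⟩ := Finset.mem_image.1 hw1
      exact (h _ hw2).2.1 i rfl
    · exact (Finset.mem_union.1 hw).elim (hF.2.1 w) fun hw => (h w hw).1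
    · rcases Finset.mem_union.1 hu with huu | huu <;> rcases Finset.mem_union.1 hw with hww | hww
      · exact hF.2.2 u huu w hww
      · obtain ⟨i, -, rfl⟩ := Finset.mem_image.1 huu
        exact ((h w hww).2.2 i).symm
      · obtain ⟨i, -, rfl⟩ := Finset.mem_image.1 hww
        exact (h u huu).2.2 i
      · exact hadj u huu w hww

/-- The link of a face is the join of the reduced order complexes of the products of chains
attached to its blocks. -/
theorem link_isomorphic_join (hq : 1 ≤ q) (hv : StrictMono v)
    (hF : Finset.univ.image v ∈ (edgewise n q).faces) (M : Multiset (Σ m : ℕ, m.Partition))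
    (e : M.ToType ≃ Fin (s + 1)) (he : ∀ i, i.1.2.parts = chainLengths q v (e i)) :
    Isomorphic (link (edgewise n q) (Finset.univ.image v)) (joinOfChainProductComplexes M) := by
  have hadj := adjacent_of_mem_faces hq hF
  have hW : ∀ i, v i ∈ latticePoints n q := fun i =>
    ((mem_edgewise_faces_iff hq _).1 hF).2.1 _ (Finset.mem_image_of_mem v (Finset.mem_univ i))
  choose a hale habot hatop hamem using fun i => exists_chainProduct_fiberUpperSets
    (cyclicKey_injective (q := q) (v (e i))) (he i)
  have hainj : ∀ i, Function.Injective (a i) := fun i x y hxy =>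
    le_antisymm ((hale i x y).1 hxy.subset) ((hale i y x).1 hxy.superset)
  have hasub : ∀ i x, a i x ⊆ block v (e i) := fun i x => ((hamem i _).1 ⟨x, rfl⟩).1
  -- A link vertex is described in two ways: from `v (e i)`, where membership in the lattice is
  -- visible, and through `B` from the common base `v 0`, where adjacency becomes inclusion.
  let f : (Σ i : M.ToType, {x : ChainProduct i.1.2.parts // x ≠ ⊥ ∧ x ≠ ⊤}) → Fin n → ℤ :=
    fun p => shift (v (e p.1)) (a p.1 p.2.1)
  let B : (Σ i : M.ToType, {x : ChainProduct i.1.2.parts // x ≠ ⊥ ∧ x ≠ ⊤}) →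
    Finset (Fin (n + 1)) := fun p => differSet (v 0) (v (e p.1)) ∪ a p.1 p.2.1
  have hfB : ∀ p, f p = shift (v 0) (B p) := fun p => shift_eq_shift_zero hv hadj _ (hasub _ _)
  have hdisj : ∀ p : (Σ i : M.ToType, {x : ChainProduct i.1.2.parts // x ≠ ⊥ ∧ x ≠ ⊤}),
      Disjoint (differSet (v 0) (v (e p.1))) (a p.1 p.2.1) := fun p =>
    (disjoint_differSet_block hv hadj _).mono_right (hasub _ _)
  have hlow : ∀ p : (Σ i : M.ToType, {x : ChainProduct i.1.2.parts // x ≠ ⊥ ∧ x ≠ ⊤}),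
      differSet (v 0) (v (e p.1)) ⊂ B p := by
    rintro ⟨i, x, hx⟩
    refine Finset.subset_union_left.ssubset_of_ne fun h => hx.1 (hainj i ?_)
    rw [habot]
    exact disjoint_self.1 ((hdisj ⟨i, x, hx⟩).mono_left (Finset.left_eq_union.1 h))
  have hhigh : ∀ p : (Σ i : M.ToType, {x : ChainProduct i.1.2.parts // x ≠ ⊥ ∧ x ≠ ⊤}),
      B p ⊂ differSet (v 0) (v (e p.1)) ∪ block v (e p.1) := by
    rintro ⟨i, x, hx⟩
    refine (Finset.union_subset_union_right (hasub i x)).ssubset_of_ne fun h => hx.2 (hainj i ?_)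
    rw [hatop]
    refine (hasub i x).antisymm fun l hl => ?_
    have : l ∈ differSet (v 0) (v (e i)) ∪ a i x := h.symm.subset (Finset.mem_union_right _ hl)
    exact (Finset.mem_union.1 this).resolve_left
      (Finset.disjoint_right.1 (disjoint_differSet_block hv hadj _) hl)
  have hBuniv : ∀ p, B p ≠ Finset.univ := fun p h =>
    (hhigh p).not_subset (h.symm ▸ Finset.subset_univ _)
  have hBlt : ∀ p p' : (Σ i : M.ToType, {x : ChainProduct i.1.2.parts // x ≠ ⊥ ∧ x ≠ ⊤}),
      e p.1 < e p'.1 → B p ⊂ B p' := fun p p' h =>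
    ((hhigh p).trans_subset (differSet_union_block_subset hv h)).trans (hlow p')
  have hBle : ∀ i x y, B ⟨i, x⟩ ⊆ B ⟨i, y⟩ ↔ x ≤ y := by
    intro i x y
    rw [← Subtype.coe_le_coe, ← hale]
    refine ⟨fun h l hl => ?_, fun h => Finset.union_subset_union_right h⟩
    exact (Finset.mem_union.1 (h (Finset.mem_union_right _ hl))).resolve_left
      (Finset.disjoint_right.1 (hdisj ⟨i, x⟩) hl)
  have hne : ∀ i j : M.ToType, i ≠ j → e i < e j ∨ e j < e i := fun i j h =>
    (e.injective.ne h).lt_or_gt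
  have hBinj : Function.Injective B := by
    rintro ⟨i, x⟩ ⟨j, y⟩ h
    by_cases hij : i = j
    · subst hij
      rw [le_antisymm ((hBle i x y).1 h.subset) ((hBle i y x).1 h.superset)]
    · rcases hne i j hij with h' | h'
      · exact absurd h (hBlt ⟨i, x⟩ ⟨j, y⟩ h').ne
      · exact absurd h (hBlt ⟨j, y⟩ ⟨i, x⟩ h').ne'
  have hfinj : Function.Injective f := fun p p' h => hBinj
    (shift_injective_of_ne_univ (v 0) (hBuniv p) (hBuniv p') (by rw [← hfB, ← hfB, h]))
  have hfW : ∀ p, f p ∈ latticePoints n q := fun p =>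
    (shift_mem_latticePoints_iff_isFiberUpperSet hv hadj hq hW _ (hasub _ _)).2
      ((hamem _ _).1 ⟨_, rfl⟩)
  have hcomp : ∀ p i, B p ⊂ differSet (v 0) (v i) ∨ differSet (v 0) (v i) ⊂ B p := by
    intro p i
    rcases lt_or_ge (e p.1) i with h | h
    · exact Or.inl ((hhigh p).trans_subset (differSet_union_block_subset hv h))
    · exact Or.inr ((differSet_mono hv h).trans_ssubset (hlow p))
  have hdu : ∀ i, differSet (v 0) (v i) ≠ Finset.univ := fun i h =>
    last_notMem_differSet (h ▸ Finset.mem_univ _)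
  have hrange : ∀ w, (∃ p, f p = w) ↔
      w ∈ latticePoints n q ∧ (∀ i, w ≠ v i) ∧ ∀ i, Adjacent w (v i) := by
    intro w
    constructor
    · rintro ⟨p, rfl⟩
      refine ⟨hfW p, fun i hi => ?_, fun i => ?_⟩
      · rw [hfB, ← shift_differSet_zero hv hadj i] at hi
        have := shift_injective_of_ne_univ _ (hBuniv p) (hdu i) hi
        exact (hcomp p i).elim (fun h => h.ne this) fun h => h.ne' this
      · rw [hfB, ← shift_differSet_zero hv hadj i, adjacent_shift_iff]
        exact (hcomp p i).imp (fun h => h.subset) fun h => h.subset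
    · rintro ⟨hwW, hwne, hwadj⟩
      obtain ⟨C, hC, rfl⟩ := exists_shift_eq_of_adjacent (hwadj 0).symm
      -- Adjacency to all of `F` makes `C` comparable with the whole chain. The part of `C` in its
      -- gap is an upper set, and the strict inclusions exclude `⊥` and `⊤`.
      obtain ⟨i, hi1, hi2⟩ := exists_between_differSet hv hC
        (fun i hi => hwne i (by rw [hi, shift_differSet_zero hv hadj]))
        (fun i => by
          rw [← adjacent_shift_iff, shift_differSet_zero hv hadj]
          exact hwadj i)
      obtain ⟨j, rfl⟩ := e.surjective i
      have hA : C \ differSet (v 0) (v (e j)) ⊆ block v (e j) := fun l hl => by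
        rw [Finset.mem_sdiff] at hl
        exact (Finset.mem_union.1 (hi2.subset hl.1)).resolve_left hl.2
      have hCA : differSet (v 0) (v (e j)) ∪ (C \ differSet (v 0) (v (e j))) = C :=
        Finset.union_sdiff_of_subset hi1.subset
      have hshift := shift_eq_shift_zero hv hadj (e j) hA
      rw [hCA] at hshift
      rw [← hshift, shift_mem_latticePoints_iff_isFiberUpperSet hv hadj hq hW _ hA] at hwW
      obtain ⟨x, hx⟩ := (hamem j _).2 hwW
      refine ⟨⟨j, x, fun h => ?_, fun h => ?_⟩, ?_⟩
      · rw [h, habot] at hx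
        rw [← hx, Finset.union_empty] at hCA
        exact hi1.ne hCA
      · rw [h, hatop] at hx
        rw [← hx] at hCA
        exact hi2.ne hCA.symm
      · exact (congrArg (shift (v (e j))) hx).trans hshift
  refine isomorphic_of_injective ⟨f, hfinj⟩ (fun t => ?_) fun w hw => ?_
  · rw [mem_link_edgewise_faces_iff hq hF]
    refine (mem_join_orderComplex_faces_iff t).trans ?_
    rw [Finset.map_nonempty]
    refine and_congr_right fun _ => ⟨fun h => ⟨fun w hw => ?_, ?_⟩, fun h i x y hx hy => ?_⟩
    · obtain ⟨p, -, rfl⟩ := Finset.mem_map.1 hw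
      exact (hrange _).1 ⟨p, rfl⟩
    · intro u hu w hw
      obtain ⟨⟨i, x⟩, hx, rfl⟩ := Finset.mem_map.1 hu
      obtain ⟨⟨j, y⟩, hy, rfl⟩ := Finset.mem_map.1 hw
      change Adjacent (f ⟨i, x⟩) (f ⟨j, y⟩)
      rw [hfB, hfB, adjacent_shift_iff]
      by_cases hij : i = j
      · subst hij
        rw [hBle, hBle]
        exact h i x y hx hy
      -- Vertices from different blocks are always adjacent: this is the join structure.
      · exact (hne i j hij).imp (fun h => (hBlt ⟨i, x⟩ ⟨j, y⟩ h).subset)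
          fun h => (hBlt ⟨j, y⟩ ⟨i, x⟩ h).subset
    · have := h.2 (f ⟨i, x⟩) (Finset.mem_map_of_mem _ hx) (f ⟨i, y⟩) (Finset.mem_map_of_mem _ hy)
      rwa [hfB, hfB, adjacent_shift_iff, hBle, hBle] at this
  · have := (mem_link_edgewise_faces_iff hq hF _).1 hw
    exact (hrange w).2 (this.2.1 w (Finset.mem_singleton_self w))

end Links

/-! ### Existence and uniqueness of the pair -/

section Pairs

variable {n q : ℕ}

theorem exists_strictMono_image_eq {F : Finset (Fin n → ℤ)} (hne : F.Nonempty)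
    (hF : IsChain (· ≤ ·) (F : Set (Fin n → ℤ))) :
    ∃ (s : ℕ) (v : Fin (s + 1) → Fin n → ℤ), StrictMono v ∧ Finset.univ.image v = F := by
  classical
  obtain ⟨s, hs⟩ := Nat.exists_eq_succ_of_ne_zero hne.card_pos.ne'
  let _ : LinearOrder (F : Set (Fin n → ℤ)) := hF.linearOrder
  let _ : Fintype (F : Set (Fin n → ℤ)) := F.fintypeCoeSort
  let g : Fin (s + 1) ≃o (F : Set (Fin n → ℤ)) :=
    Fintype.orderIsoFinOfCardEq _ ((Fintype.card_coe F).trans hs)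
  refine ⟨s, fun i => (g i).1, fun i j hij => g.strictMono hij, Finset.ext fun w => ?_⟩
  rw [Finset.mem_image]
  constructor
  · rintro ⟨i, -, rfl⟩
    exact (g i).2
  · intro hw
    exact ⟨g.symm ⟨w, hw⟩, Finset.mem_univ _, by rw [g.apply_symm_apply]⟩

theorem chainLengths_sum {s : ℕ} (q : ℕ) (v : Fin (s + 1) → Fin n → ℤ) (i : Fin (s + 1)) :
    (chainLengths q v i).sum = (block v i).card :=
  (Finset.card_eq_sum_card_image (chainLabel q (v i)) (block v i)).symm

theorem chainLengths_pos {s : ℕ} {q : ℕ} {v : Fin (s + 1) → Fin n → ℤ} {i : Fin (s + 1)} {m : ℕ}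
    (hm : m ∈ chainLengths q v i) : 0 < m := by
  obtain ⟨x, hx, rfl⟩ := Multiset.mem_map.1 hm
  obtain ⟨j, hj, rfl⟩ := Finset.mem_image.1 (Finset.mem_def.2 hx)
  exact Finset.card_pos.2 ⟨j, Finset.mem_filter.2 ⟨hj, rfl⟩⟩

/-- The number partitioned is the sum of the parts, so the parts alone recover it. -/
theorem sigma_parts_injective :
    Function.Injective fun σ : Σ m : ℕ, m.Partition => σ.2.parts := by
  rintro ⟨m, σ⟩ ⟨m', σ'⟩ h
  have hm : m = m' := by
    rw [← σ.parts_sum, ← σ'.parts_sum]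
    exact congrArg Multiset.sum h
  subst hm
  exact congrArg (Sigma.mk m) (Nat.Partition.ext h)

/-- A strictly increasing enumeration is determined by its image, so `F` fixes `s` and `v`, and
these fix both entries of the pair. -/
theorem IsPairOfFace.unique {F : Finset (Fin n → ℤ)} {lam lam' : (n + 1).Partition}
    {M M' : Multiset (Σ m : ℕ, m.Partition)} (h : IsPairOfFace q F lam M)
    (h' : IsPairOfFace q F lam' M') : lam' = lam ∧ M' = M := by
  obtain ⟨s, v, hv, hF, hlam, hM⟩ := h
  obtain ⟨s', v', hv', hF', hlam', hM'⟩ := h'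
  have hs : s = s' := by
    have h1 := Finset.card_image_of_injective Finset.univ hv.injective
    have h2 := Finset.card_image_of_injective Finset.univ hv'.injective
    rw [hF, Finset.card_univ, Fintype.card_fin] at h1
    rw [hF', Finset.card_univ, Fintype.card_fin] at h2
    omega
  subst hs
  have hvv : v = v' := by
    refine (StrictMono.range_inj hv hv').1 ?_
    have := congrArg (fun s : Finset (Fin n → ℤ) => (s : Set (Fin n → ℤ))) (hF.trans hF'.symm)
    simpa using this
  subst hvv
  refine ⟨Nat.Partition.ext (hlam'.trans hlam.symm), ?_⟩
  exact Multiset.map_injective sigma_parts_injective (hM'.trans hM.symm)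

end Pairs

theorem exists_pair_of_face {n q : ℕ} (hq : 1 ≤ q) {F : Finset (Fin n → ℤ)}
    (hF : F ∈ (edgewise n q).faces) :
    ∃ (lam : (n + 1).Partition) (M : Multiset (Σ m : ℕ, m.Partition)),
      lam.parts.card = F.card ∧ M.map (fun σ => σ.1) = lam.parts ∧ IsPairOfFace q F lam M ∧
      Isomorphic (link (edgewise n q) F) (joinOfChainProductComplexes M) := by
  have hF' := (mem_edgewise_faces_iff hq F).1 hF
  obtain ⟨s, v, hv, rfl⟩ := exists_strictMono_image_eq hF'.1
    fun u hu w hw _ => (hF'.2.2 u hu w hw).le_or_le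
  have hadj := adjacent_of_mem_faces hq hF
  let σ : Fin (s + 1) → Σ m : ℕ, m.Partition := fun i => ⟨(block v i).card,
    { parts := chainLengths q v i
      parts_pos := chainLengths_pos
      parts_sum := chainLengths_sum q v i }⟩
  let lam : (n + 1).Partition :=
    { parts := Finset.univ.val.map fun i => (block v i).card
      parts_pos := fun {m} hm => by
        obtain ⟨i, -, rfl⟩ := Multiset.mem_map.1 hm
        exact (block_nonempty hv i).card_pos
      parts_sum := card_block_sum hv hadj }
  let M : Multiset (Σ m : ℕ, m.Partition) := Finset.univ.val.map σ
  obtain ⟨e, he⟩ := exists_equiv_toType_map σ (m := M) rfl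
  refine ⟨lam, M, ?_, Multiset.map_map _ _ _, ⟨s, v, hv, rfl, rfl, Multiset.map_map _ _ _⟩,
    link_isomorphic_join hq hv hF M e fun i => ?_⟩
  · rw [Finset.card_image_of_injective _ hv.injective]
    exact Multiset.card_map (fun i => (block v i).card) Finset.univ.val
  · rw [he i]

end EdgewiseLinks

theorem mainTheorem7 (n q : ℕ) (hq : 1 ≤ q) :
    (∀ (t : ℕ) (F : Finset (Fin n → ℤ)), F ∈ (EdgewiseLinks.edgewise n q).faces → F.card = t →
      ∃ (lam : (n + 1).Partition) (M : Multiset (Σ m : ℕ, m.Partition)),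
        lam.parts.card = t ∧
        M.map (fun σ => σ.1) = lam.parts ∧
        EdgewiseLinks.IsPairOfFace q F lam M ∧
        (∀ (lam' : (n + 1).Partition) (M' : Multiset (Σ m : ℕ, m.Partition)),
          EdgewiseLinks.IsPairOfFace q F lam' M' → lam' = lam ∧ M' = M) ∧
        EdgewiseLinks.Isomorphic
          (EdgewiseLinks.link (EdgewiseLinks.edgewise n q) F)
          (EdgewiseLinks.joinOfChainProductComplexes M)) ∧
    (∀ (F G : Finset (Fin n → ℤ)), F ∈ (EdgewiseLinks.edgewise n q).faces →
      G ∈ (EdgewiseLinks.edgewise n q).faces →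
      ∀ (lam : (n + 1).Partition) (M : Multiset (Σ m : ℕ, m.Partition)),
        EdgewiseLinks.IsPairOfFace q F lam M → EdgewiseLinks.IsPairOfFace q G lam M →
        EdgewiseLinks.Isomorphic
          (EdgewiseLinks.link (EdgewiseLinks.edgewise n q) F)
          (EdgewiseLinks.link (EdgewiseLinks.edgewise n q) G)) := by
  constructor
  · rintro t F hF rfl
    obtain ⟨lam, M, h1, h2, h3, h4⟩ := EdgewiseLinks.exists_pair_of_face hq hF
    exact ⟨lam, M, h1, h2, h3, fun _ _ h => h3.unique h, h4⟩
  · intro F G hF hG lam M hFM hGM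
    obtain ⟨lam1, M1, -, -, h1, h1'⟩ := EdgewiseLinks.exists_pair_of_face hq hF
    obtain ⟨lam2, M2, -, -, h2, h2'⟩ := EdgewiseLinks.exists_pair_of_face hq hG
    obtain ⟨-, rfl⟩ := hFM.unique h1
    obtain ⟨-, rfl⟩ := hGM.unique h2
    exact h1'.trans h2'.symm
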